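/- Consider the linear relaxation system $U_t+AU_x=\frac1{\epsilon(x)}QU$ on $\mathbb R$, with $U=(u,v)\in\mathbb R^{n-m}\times\mathbb R^m$, $\epsilon(x)=1$ for $x\le 0$ and $\epsilon(x)=\epsilon>0$ small for $x>0$. Assume the structural stability condition in its normal form: $A=\begin{pmatrix}A_{11}&A_{12}\\A_{12}^T&A_{22}\end{pmatrix}$ and $Q=\mathrm{diag}(0,S)$ are real symmetric $n\times n$ matrices, with $S\in\mathbb R^{m\times m}$ negative definite. Assume also that the interface $x=0$ is non-characteristic: $\det A\ne 0$. **Notation.** Let $n^+,n^-$ be the numbers of positive and negative eigenvalues of $A$, and $n_1^+,n_1^-,n_1^o$ the numbers of positive, negative and zero eigenvalues of $A_{11}$, counted with multiplicity. Let $(R_+,R_-)$ be orthonormal eigenvectors of $A$ for its positive and negative eigenvalues, so $AR_\pm=R_\pm\Lambda_\pm$, and let $(P_+,P_-,P_0)$ be orthonormal eigenvectors of $A_{11}$ for its positive, negative and zero eigenvalues, so $A_{11}P_\pm=P_\pm\Lambda_{1\pm}$ and $A_{11}P_0=0$, where $\Lambda_\pm,\Lambda_{1\pm}$ are diagonal.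 Put $G=P_+\Lambda_{1+}^{-1}P_+^T+P_-\Lambda_{1-}^{-1}P_-^T$, $K=A_{12}^TP_0$, $X=A_{22}-A_{12}^TGA_{12}$. Let $\tilde K$ be a matrix whose columns form a basis of the orthogonal complement in $\mathbb R^m$ of the column space of $K$, and put $$N=-GA_{12}\tilde K+P_0(K^TK)^{-1}\big[(K^TS\tilde K)(\tilde K^TS\tilde K)^{-1}(\tilde K^TX\tilde K)-K^TX\tilde K\big].$$ Let $R_S$ be a right-stable matrix of $M=(\tilde K^TX\tilde K)^{-1}(\tilde K^TS\tilde K)$: it is real with full column rank, it has as many columns as $M$ has eigenvalues with negative real part (with multiplicity), and $MR_S=R_ST$ for some matrix $T$ all of whose eigenvalues have negative real part. Matching at $x=0$ the left state $U^l=R_+\alpha_++R_-\alpha_-$ with the equilibrium outer state $u^r=P_+\beta_++P_-\beta_-+P_0\beta_0$ plus the boundary-layer corrections, $$U^l=\begin{pmatrix}u^r\\0\end{pmatrix}+\begin{pmatrix}P_0\hat w\\0\end{pmatrix}+\begin{pmatrix}N\\\tilde K\end{pmatrix}R_S\tilde w^S,\tag{1}$$ gives the linear system $$\left(-R_-,\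 \begin{pmatrix}P_+\\0\end{pmatrix},\ \begin{pmatrix}P_0\\0\end{pmatrix},\ \begin{pmatrix}NR_S\\\tilde KR_S\end{pmatrix}\right)\begin{pmatrix}\alpha_-\\\beta_+\\\hat w\\\tilde w^S\end{pmatrix}=R_+\alpha_+-\begin{pmatrix}P_-\beta_-\\0\end{pmatrix}-\begin{pmatrix}P_0\beta_0\\0\end{pmatrix}.\tag{2}$$ **Theorem.** The matrices $K^TK$, $\tilde K^TX\tilde K$ and $\tilde K^TS\tilde K$ are invertible, so that (2) is well defined. $R_S$ has $n^+-n_1^o-n_1^+$ columns, so that (2) consists of $n$ equations in $n^-+n_1^++n_1^o+(n^+-n_1^o-n_1^+)=n$ unknowns. Its coefficient matrix is invertible; in particular, for all $\alpha_+,\beta_-,\beta_0$ the system (2) has exactly one solution $(\alpha_-,\beta_+,\hat w,\tilde w^S)$. Moreover, there are constant matrices $B_{l,l},B_{l,r},B_{r,r},B_{r,l}$ of sizes $n^-\times n^+$, $n^-\times n_1^-$, $n_1^+\times n_1^-$ and $n_1^+\times n^+$, respectively, such that for all $\alpha_\pm,\beta_\pm,\beta_0$ the matching relation (1) holds for some $\hat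 w,\tilde w^S$ if and only if $$\alpha_-=B_{l,l}\alpha_++B_{l,r}\beta_-,\qquad \beta_+=B_{r,r}\beta_-+B_{r,l}\alpha_+ .$$ In particular the coupling conditions do not involve $\beta_0$. -/

import Mathlib

open Matrix

noncomputable section

namespace Relaxation

/-! ### Eigenvalue counts (with multiplicity) and stable matrices -/

/-- Number of positive real eigenvalues, with multiplicity. -/
def numPosEig {ι : Type*} [Fintype ι] [DecidableEq ι] (M : Matrix ι ι ℝ) : ℕ :=
  M.charpoly.roots.countP (fun z => 0 < z)

/-- Number of negative real eigenvalues, with multiplicity. -/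
def numNegEig {ι : Type*} [Fintype ι] [DecidableEq ι] (M : Matrix ι ι ℝ) : ℕ :=
  M.charpoly.roots.countP (fun z => z < 0)

/-- Multiplicity of the eigenvalue zero. -/
def numZeroEig {ι : Type*} [Fintype ι] [DecidableEq ι] (M : Matrix ι ι ℝ) : ℕ :=
  M.charpoly.roots.countP (fun z => z = 0)

/-- The complex eigenvalues, with multiplicity, of a real square matrix. -/
def complexEigenvalues {ι : Type*} [Fintype ι] [DecidableEq ι] (M : Matrix ι ι ℝ) :
    Multiset ℂ :=
  (M.map (algebraMap ℝ ℂ)).charpoly.roots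

/-- A stable matrix: all its complex eigenvalues have negative real part. -/
def IsStableMatrix {ι : Type*} [Fintype ι] [DecidableEq ι] (M : Matrix ι ι ℝ) : Prop :=
  ∀ z ∈ complexEigenvalues M, z.re < 0

open Classical in
/-- Number of complex eigenvalues with negative real part, with multiplicity. -/
def numStableEig {ι : Type*} [Fintype ι] [DecidableEq ι] (M : Matrix ι ι ℝ) : ℕ :=
  (complexEigenvalues M).countP (fun z => z.re < 0)

/-- `RS` is a right-stable matrix of `M`: it has as many columns as `M` has stable eigenvalues,
it has full column rank, and `M * RS = RS * T` for some stable matrix `T`. -/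
structure IsRightStable {q s : ℕ} (M : Matrix (Fin q) (Fin q) ℝ)
    (RS : Matrix (Fin q) (Fin s) ℝ) : Prop where
  size : s = numStableEig M
  fullRank : Function.Injective RS.mulVec
  invariant : ∃ T : Matrix (Fin s) (Fin s) ℝ, IsStableMatrix T ∧ M * RS = RS * T

/-! ### The relaxation system `U_t + A U_x = Q U / ε(x)`, with `U = (u, v) ∈ ℝ^r × ℝ^m` -/

/-- The structural stability condition in its normal form: `A` and `Q` are symmetric and
`Q = diag(0, S)` with `S` (of size `m × m`) negative definite. -/
structure StructuralStability {r m : ℕ} (A Q : Matrix (Fin r ⊕ Fin m) (Fin r ⊕ Fin m) ℝ) :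
    Prop where
  symm_A : A.IsSymm
  block_Q : ∃ S : Matrix (Fin m) (Fin m) ℝ, S.IsSymm ∧ (-S).PosDef ∧ Q = fromBlocks 0 0 0 S

/-- Characteristic decomposition of `A`: orthonormal eigenvectors `R = (R₊, R₋)` belonging to the
positive and the negative eigenvalues of `A`. -/
structure CharDecomp {ι : Type*} [Fintype ι] [DecidableEq ι] (A : Matrix ι ι ℝ) (np nm : ℕ) where
  Rp : Matrix ι (Fin np) ℝ
  Rm : Matrix ι (Fin nm) ℝ
  Lp : Fin np → ℝ
  Lm : Fin nm → ℝ
  size_pos : np = numPosEig A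
  size_neg : nm = numNegEig A
  pos : ∀ i, 0 < Lp i
  neg : ∀ i, Lm i < 0
  orthonormal : (fromCols Rp Rm)ᵀ * fromCols Rp Rm = 1
  eigen_pos : A * Rp = Rp * diagonal Lp
  eigen_neg : A * Rm = Rm * diagonal Lm

/-- Characteristic decomposition of `A₁₁`: orthonormal eigenvectors `P = (P₊, P₋, P₀)` belonging
to the positive, the negative and the zero eigenvalues of `A₁₁`. -/
structure CharDecompEq {ι : Type*} [Fintype ι] [DecidableEq ι] (A₁₁ : Matrix ι ι ℝ)
    (n1p n1m n1o : ℕ) where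
  Pp : Matrix ι (Fin n1p) ℝ
  Pm : Matrix ι (Fin n1m) ℝ
  P0 : Matrix ι (Fin n1o) ℝ
  Lp : Fin n1p → ℝ
  Lm : Fin n1m → ℝ
  size_pos : n1p = numPosEig A₁₁
  size_neg : n1m = numNegEig A₁₁
  size_zero : n1o = numZeroEig A₁₁
  pos : ∀ i, 0 < Lp i
  neg : ∀ i, Lm i < 0
  orthonormal : (fromCols Pp (fromCols Pm P0))ᵀ * fromCols Pp (fromCols Pm P0) = 1
  eigen_pos : A₁₁ * Pp = Pp * diagonal Lp
  eigen_neg : A₁₁ * Pm = Pm * diagonal Lm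
  eigen_zero : A₁₁ * P0 = 0

/-- `P₊ Λ₁₊⁻¹ P₊ᵀ + P₋ Λ₁₋⁻¹ P₋ᵀ`. -/
def CharDecompEq.pinv {ι : Type*} [Fintype ι] [DecidableEq ι] {A₁₁ : Matrix ι ι ℝ}
    {n1p n1m n1o : ℕ} (P : CharDecompEq A₁₁ n1p n1m n1o) : Matrix ι ι ℝ :=
  P.Pp * diagonal (fun i => (P.Lp i)⁻¹) * P.Ppᵀ + P.Pm * diagonal (fun i => (P.Lm i)⁻¹) * P.Pmᵀ

section Layer

variable {r m n1p n1m n1o q s : ℕ}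

/-- `K = A₁₂ᵀ P₀`. -/
def matK (A : Matrix (Fin r ⊕ Fin m) (Fin r ⊕ Fin m) ℝ)
    (P : CharDecompEq A.toBlocks₁₁ n1p n1m n1o) : Matrix (Fin m) (Fin n1o) ℝ :=
  A.toBlocks₁₂ᵀ * P.P0

/-- The columns of `Kt` form a basis of the orthogonal complement in `ℝ^m` of the column space
of `K`. -/
def IsOrthogonalComplement (K : Matrix (Fin m) (Fin n1o) ℝ) (Kt : Matrix (Fin m) (Fin q) ℝ) :
    Prop :=
  Function.Injective Kt.mulVec ∧ ∀ v : Fin m → ℝ, Kᵀ *ᵥ v = 0 ↔ ∃ w, v = Kt *ᵥ w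

/-- `X = A₂₂ - A₁₂ᵀ (P₊ Λ₁₊⁻¹ P₊ᵀ + P₋ Λ₁₋⁻¹ P₋ᵀ) A₁₂`. -/
def matX (A : Matrix (Fin r ⊕ Fin m) (Fin r ⊕ Fin m) ℝ)
    (P : CharDecompEq A.toBlocks₁₁ n1p n1m n1o) : Matrix (Fin m) (Fin m) ℝ :=
  A.toBlocks₂₂ - A.toBlocks₁₂ᵀ * P.pinv * A.toBlocks₁₂

/-- The matrix `N` of the boundary-layer correction `(N, K̃) w̃`; here `S` is the lower right
block of `Q`. -/
def matN (A Q : Matrix (Fin r ⊕ Fin m) (Fin r ⊕ Fin m) ℝ)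
    (P : CharDecompEq A.toBlocks₁₁ n1p n1m n1o) (Kt : Matrix (Fin m) (Fin q) ℝ) :
    Matrix (Fin r) (Fin q) ℝ :=
  let K := matK A P
  let X := matX A P
  let S := Q.toBlocks₂₂;
  (-P.pinv) * A.toBlocks₁₂ * Kt
    + P.P0 * (Kᵀ * K)⁻¹ *
      ((Kᵀ * S * Kt) * (Ktᵀ * S * Kt)⁻¹ * (Ktᵀ * X * Kt) - Kᵀ * X * Kt)

/-- The coefficient matrix `(K̃ᵀ X K̃)⁻¹ (K̃ᵀ S K̃)` of the boundary-layer equation for `w̃`. -/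
def layerMatrix (A Q : Matrix (Fin r ⊕ Fin m) (Fin r ⊕ Fin m) ℝ)
    (P : CharDecompEq A.toBlocks₁₁ n1p n1m n1o) (Kt : Matrix (Fin m) (Fin q) ℝ) :
    Matrix (Fin q) (Fin q) ℝ :=
  (Ktᵀ * matX A P * Kt)⁻¹ * (Ktᵀ * Q.toBlocks₂₂ * Kt)

variable {np nm : ℕ}

/-- The coefficient matrix `(-R₋, (P₊; 0), (P₀; 0), (N R_S; K̃ R_S))` of the coupling system for
the unknowns `(α₋, β₊, ŵ, w̃ˢ)`. -/
def couplingMatrix (A Q : Matrix (Fin r ⊕ Fin m) (Fin r ⊕ Fin m) ℝ) (R : CharDecomp A np nm)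
    (P : CharDecompEq A.toBlocks₁₁ n1p n1m n1o) (Kt : Matrix (Fin m) (Fin q) ℝ)
    (RS : Matrix (Fin q) (Fin s) ℝ) :
    Matrix (Fin r ⊕ Fin m) (Fin nm ⊕ (Fin n1p ⊕ (Fin n1o ⊕ Fin s))) ℝ :=
  fromCols (-R.Rm) (fromCols (fromRows P.Pp 0) (fromCols (fromRows P.P0 0)
    (fromRows (matN A Q P Kt * RS) (Kt * RS))))

/-- The right-hand side `R₊ α₊ - (P₋ β₋; 0) - (P₀ β₀; 0)` of the coupling system. -/
def couplingRhs (A : Matrix (Fin r ⊕ Fin m) (Fin r ⊕ Fin m) ℝ) (R : CharDecomp A np nm)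
    (P : CharDecompEq A.toBlocks₁₁ n1p n1m n1o)
    (αp : Fin np → ℝ) (βm : Fin n1m → ℝ) (β0 : Fin n1o → ℝ) : Fin r ⊕ Fin m → ℝ :=
  R.Rp *ᵥ αp - Sum.elim (P.Pm *ᵥ βm) 0 - Sum.elim (P.P0 *ᵥ β0) 0

/-- The matching relation at `x = 0`:
`Uˡ = (uʳ; 0) + (P₀ ŵ; 0) + (N; K̃) w̃`, where `w̃ = R_S w̃ˢ` lies in the stable manifold. -/
def Matching (A Q : Matrix (Fin r ⊕ Fin m) (Fin r ⊕ Fin m) ℝ)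
    (P : CharDecompEq A.toBlocks₁₁ n1p n1m n1o) (Kt : Matrix (Fin m) (Fin q) ℝ)
    (RS : Matrix (Fin q) (Fin s) ℝ) (Ul : Fin r ⊕ Fin m → ℝ) (ur : Fin r → ℝ)
    (wHat : Fin n1o → ℝ) (wS : Fin s → ℝ) : Prop :=
  Ul = Sum.elim ur 0 + Sum.elim (P.P0 *ᵥ wHat) 0
    + Sum.elim (matN A Q P Kt *ᵥ (RS *ᵥ wS)) (Kt *ᵥ (RS *ᵥ wS))

end Layer

end Relaxation

end

/-!
The proof is an energy argument for the quadratic form `Uᵀ A U`.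

By construction of `N`, the matrix `A` maps a layer correction `(N y, Kt y)` to a vector whose
equilibrium part vanishes, so that the correction is `A`-orthogonal to all outer states `(p, 0)` and
has energy `yᵀ (Ktᵀ X Kt) y` (`energy_layer`). On the columns of `P₊` the energy is positive, on those
of `P₀` it is zero. On the stable subspace of the layer equation it is positive as well
(`form_pos_of_stable`): the negative definite form `Ktᵀ S Kt` and the nondegenerate form `Ktᵀ X Kt`
are diagonalized simultaneously as `-1` and `diag(e)`, hence `M = (Ktᵀ X Kt)⁻¹ (Ktᵀ S Kt)` is
diagonalizable with the real eigenvalues `-1 / e i`, and its stable directions are those with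
`e i > 0`. On the columns of `R₋` the energy is negative. A linear relation between the columns of
the coupling matrix equates a vector of nonpositive energy with one of nonnegative energy and is
therefore trivial, up to the columns of `P₀`, which are independent (`fromCols_mulVec_injective`).

Injectivity bounds the number of columns by `n`, which is one half of the count
`s + n₁ᵒ + n₁⁺ = n⁺`. The other half is the same argument with reversed signs, for `R₊`, `P₋`, `P₀`
and the directions with `e i < 0` (`couplingMatrix_injective_and_size`). So the coupling matrix is
square and invertible. The matching relation is the coupling system in which `ŵ` is replaced by
`ŵ + β₀` and the right-hand side is free of `β₀` (`matching_iff`); the coupling conditions are the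
`α₋` and `β₊` rows of the inverse matrix.
-/

open Matrix

noncomputable section

namespace Relaxation

/-! ### Eigenvalue counts of symmetric matrices -/

lemma mulVec_dotProduct {ι κ : Type*} [Fintype ι] [Fintype κ] (M : Matrix ι κ ℝ)
    (a : κ → ℝ) (b : ι → ℝ) : M *ᵥ a ⬝ᵥ b = a ⬝ᵥ Mᵀ *ᵥ b := by
  rw [mulVec_transpose, dotProduct_comm, dotProduct_mulVec, dotProduct_comm]

/-- If the columns of `V` are orthogonal for the form `X`, the form is a weighted sum of squares on
their span. -/
lemma dotProduct_mulVec_eq_sum {ι κ : Type*} [Fintype ι] [Fintype κ] [DecidableEq κ]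
    {X : Matrix ι ι ℝ} {V : Matrix ι κ ℝ} {e : κ → ℝ} (hVX : Vᵀ * X * V = diagonal e)
    (c : κ → ℝ) : V *ᵥ c ⬝ᵥ X *ᵥ (V *ᵥ c) = ∑ i, e i * c i ^ 2 := by
  have : V *ᵥ c ⬝ᵥ X *ᵥ (V *ᵥ c) = c ⬝ᵥ (Vᵀ * X * V) *ᵥ c := by
    rw [mulVec_dotProduct, mulVec_mulVec, mulVec_mulVec, Matrix.mul_assoc]
  rw [this, hVX, dotProduct]
  refine Finset.sum_congr rfl fun i _ => ?_
  rw [mulVec_diagonal]; ring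

lemma numPosEig_add_numNegEig_add_numZeroEig {ι : Type*} [Fintype ι] [DecidableEq ι]
    {A : Matrix ι ι ℝ} (hA : A.IsSymm) :
    numPosEig A + numNegEig A + numZeroEig A = Fintype.card ι := by
  have hH : A.IsHermitian := by rwa [IsHermitian, conjTranspose_eq_transpose_of_trivial]
  have hcard : A.charpoly.roots.card = Fintype.card ι := by
    rw [hH.roots_charpoly_eq_eigenvalues]; simp
  rw [← hcard, numPosEig, numNegEig, numZeroEig]
  induction A.charpoly.roots using Multiset.induction_on with
  | empty => simp
  | cons a t ih =>
    simp only [Multiset.countP_cons, Multiset.card_cons]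
    rcases lt_trichotomy a 0 with h | h | h
    · rw [if_neg h.not_gt, if_pos h, if_neg h.ne]; omega
    · rw [if_neg h.le.not_gt, if_neg h.ge.not_gt, if_pos h]; omega
    · rw [if_pos h, if_neg h.not_gt, if_neg h.ne']; omega

lemma numZeroEig_eq_zero {ι : Type*} [Fintype ι] [DecidableEq ι] {A : Matrix ι ι ℝ}
    (hA : A.det ≠ 0) : numZeroEig A = 0 := by
  rw [numZeroEig, Multiset.countP_eq_zero]
  rintro z hz rfl
  apply hA
  have h0 := (Polynomial.mem_roots'.mp hz).2
  rw [Polynomial.IsRoot, eval_charpoly] at h0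
  simpa [det_neg] using h0

/-! ### Simultaneous diagonalization of a symmetric and a definite form -/

lemma exists_orthogonal_diagonalization {ι : Type*} [Fintype ι] [DecidableEq ι]
    {Y : Matrix ι ι ℝ} (hY : Y.IsSymm) :
    ∃ (O : Matrix ι ι ℝ) (d : ι → ℝ), Oᵀ * O = 1 ∧ Oᵀ * Y * O = diagonal d := by
  have hH : Y.IsHermitian := by rwa [IsHermitian, conjTranspose_eq_transpose_of_trivial]
  refine ⟨hH.eigenvectorUnitary, hH.eigenvalues, ?_, ?_⟩
  · have := Unitary.coe_star_mul_self hH.eigenvectorUnitary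
    rwa [star_eq_conjTranspose, conjTranspose_eq_transpose_of_trivial] at this
  · have := hH.conjStarAlgAut_star_eigenvectorUnitary
    rwa [Unitary.conjStarAlgAut_star_apply, star_eq_conjTranspose,
      conjTranspose_eq_transpose_of_trivial] at this

/-- A negative definite form `S` and a nondegenerate symmetric form `X` are diagonalized by one
change of basis `V`; the signs of the diagonal entries `e` give the inertia of `X`. -/
lemma exists_simultaneous_diagonalization {ι : Type*} [Fintype ι] [DecidableEq ι]
    {X S : Matrix ι ι ℝ} (hX : X.IsSymm) (hXu : IsUnit X) (hS : (-S).PosDef) :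
    ∃ (V : Matrix ι ι ℝ) (e : ι → ℝ), IsUnit V ∧ (∀ i, e i ≠ 0) ∧
      Vᵀ * X * V = diagonal e ∧ Vᵀ * S * V = -1 := by
  have hSs : (-S).IsSymm := by
    have := hS.isHermitian
    rwa [IsHermitian, conjTranspose_eq_transpose_of_trivial] at this
  obtain ⟨O, d, hO, hd⟩ := exists_orthogonal_diagonalization hSs
  have hOinj : Function.Injective O.mulVec := fun x y h => by
    simpa [mulVec_mulVec, hO] using congrArg (Oᵀ *ᵥ ·) h
  have hdpos : ∀ i, 0 < d i := by
    have := hS.conjTranspose_mul_mul_same hOinj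
    rw [conjTranspose_eq_transpose_of_trivial, hd] at this
    exact posDef_diagonal_iff.mp this
  set W := O * diagonal (fun i => (√(d i))⁻¹) with hW
  have hWS : Wᵀ * S * W = -1 := by
    have : Wᵀ * (-S) * W = 1 := by
      rw [hW, transpose_mul, diagonal_transpose]
      calc _ = diagonal (fun i => (√(d i))⁻¹) * (Oᵀ * (-S) * O)
            * diagonal (fun i => (√(d i))⁻¹) := by simp only [Matrix.mul_assoc]
        _ = 1 := by
          rw [hd, diagonal_mul_diagonal, diagonal_mul_diagonal, ← diagonal_one]
          congr 1; ext i
          have h1 := Real.sqrt_pos.mpr (hdpos i)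
          have h2 := Real.mul_self_sqrt (hdpos i).le
          field_simp
          nlinarith
    rw [← neg_neg (Wᵀ * S * W), ← this]; simp
  obtain ⟨O', e, hO', he⟩ :=
    exists_orthogonal_diagonalization (Y := Wᵀ * X * W) (by
      simp [IsSymm, transpose_mul, hX.eq, Matrix.mul_assoc])
  have hVX : (W * O')ᵀ * X * (W * O') = diagonal e := by
    rw [← he, transpose_mul]; simp only [Matrix.mul_assoc]
  have hVS : (W * O')ᵀ * S * (W * O') = -1 := by
    calc (W * O')ᵀ * S * (W * O') = O'ᵀ * (Wᵀ * S * W) * O' := by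
          rw [transpose_mul]; simp only [Matrix.mul_assoc]
      _ = -1 := by rw [hWS]; simp [hO']
  have hVu : IsUnit (W * O') := by
    refine IsUnit.of_mul_eq_one_right (-((W * O')ᵀ * S)) ?_
    rw [Matrix.neg_mul, hVS, neg_neg]
  refine ⟨W * O', e, hVu, fun i => ?_, hVX, hVS⟩
  have hu : IsUnit (diagonal e) := by
    rw [← hVX]
    exact (((isUnit_transpose _).mpr hVu).mul hXu).mul hVu
  exact (Pi.isUnit_iff.mp (isUnit_diagonal.mp hu) i).ne_zero

section Diagonalized

variable {ι : Type*} [Fintype ι] [DecidableEq ι] {X S V : Matrix ι ι ℝ} {e : ι → ℝ}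

/-- The columns of `V` are eigenvectors of `X⁻¹ S` with the real eigenvalues `-1 / e i`. -/
lemma inv_mul_mul_eq_mul_diagonal (hXu : IsUnit X) (hV : IsUnit V) (he : ∀ i, e i ≠ 0)
    (hVX : Vᵀ * X * V = diagonal e) (hVS : Vᵀ * S * V = -1) :
    X⁻¹ * S * V = V * diagonal (fun i => -(e i)⁻¹) := by
  have hVt : IsUnit Vᵀ := (isUnit_transpose _).mpr hV
  have h : S * V = X * (V * diagonal (fun i => -(e i)⁻¹)) := by
    refine hVt.mul_left_cancel ?_
    rw [← Matrix.mul_assoc, hVS, ← Matrix.mul_assoc, ← Matrix.mul_assoc, hVX,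
      diagonal_mul_diagonal, ← diagonal_one, diagonal_neg]
    congr 1; ext i
    simp [he i]
  rw [Matrix.mul_assoc, h, ← Matrix.mul_assoc,
    nonsing_inv_mul _ ((isUnit_iff_isUnit_det _).mp hXu), Matrix.one_mul]

lemma numStableEig_inv_mul (hXu : IsUnit X) (hV : IsUnit V) (he : ∀ i, e i ≠ 0)
    (hVX : Vᵀ * X * V = diagonal e) (hVS : Vᵀ * S * V = -1) :
    numStableEig (X⁻¹ * S) = Fintype.card {i // 0 < e i} := by
  classical
  have h := inv_mul_mul_eq_mul_diagonal hXu hV he hVX hVS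
  obtain ⟨v, rfl⟩ := hV
  have h2 : X⁻¹ * S = v.val * diagonal (fun i => -(e i)⁻¹) * v⁻¹.val := by
    rw [← h, Matrix.mul_assoc, Units.mul_inv, Matrix.mul_one]
  have hroots : complexEigenvalues (X⁻¹ * S)
      = Finset.univ.val.map (fun i => ((-(e i)⁻¹ : ℝ) : ℂ)) := by
    rw [complexEigenvalues, charpoly_map, h2, coe_units_inv, charpoly_units_conj,
      charpoly_diagonal, Polynomial.map_prod]
    simp only [Polynomial.map_sub, Polynomial.map_X, Polynomial.map_C]
    rw [← Polynomial.roots_multiset_prod_X_sub_C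
      (Finset.univ.val.map (fun i => ((-(e i)⁻¹ : ℝ) : ℂ))), Multiset.map_map]
    rfl
  rw [numStableEig, hroots, Multiset.countP_map, Fintype.card_subtype, Finset.card,
    Finset.filter_val]
  congr 1
  refine Multiset.filter_congr fun i _ => ?_
  simp

/-- A real left eigenvalue of a stable matrix is negative. -/
lemma IsStableMatrix.neg_of_vecMul_eq {κ : Type*} [Fintype κ] [DecidableEq κ]
    {T : Matrix κ κ ℝ} (hT : IsStableMatrix T) {v : κ → ℝ} (hv : v ≠ 0) {μ : ℝ}
    (h : v ᵥ* T = μ • v) : μ < 0 := by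
  have h0 : T.charpoly.IsRoot μ := by
    rw [Polynomial.IsRoot, eval_charpoly]
    refine exists_vecMul_eq_zero_iff.mp ⟨v, hv, ?_⟩
    rw [vecMul_sub, h, scalar_apply]
    ext i
    simp
  have := hT (μ : ℂ) (by
    rw [complexEigenvalues, charpoly_map, Polynomial.mem_roots
      (Polynomial.map_ne_zero_iff (algebraMap ℝ ℂ).injective |>.mpr T.charpoly_monic.ne_zero)]
    exact h0.map)
  simpa using this

/-- In the coordinates given by `V`, an invariant stable subspace of `X⁻¹ S` only involves
directions in which `X` is positive. -/
lemma exists_coordinates_of_stable {κ : Type*} [Fintype κ] [DecidableEq κ]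
    (hXu : IsUnit X) (hV : IsUnit V) (he : ∀ i, e i ≠ 0)
    (hVX : Vᵀ * X * V = diagonal e) (hVS : Vᵀ * S * V = -1)
    {RS : Matrix ι κ ℝ} {T : Matrix κ κ ℝ} (hT : IsStableMatrix T)
    (hRS : X⁻¹ * S * RS = RS * T) (w : κ → ℝ) :
    ∃ c : ι → ℝ, V *ᵥ c = RS *ᵥ w ∧ ∀ i, e i < 0 → c i = 0 := by
  have h := inv_mul_mul_eq_mul_diagonal hXu hV he hVX hVS
  have hVd := (isUnit_iff_isUnit_det _).mp hV
  have hRS' : RS = V * (V⁻¹ * RS) := by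
    rw [← Matrix.mul_assoc, mul_nonsing_inv _ hVd, Matrix.one_mul]
  set ρ := V⁻¹ * RS with hρ
  have hrow : diagonal (fun i => -(e i)⁻¹) * ρ = ρ * T := by
    calc diagonal (fun i => -(e i)⁻¹) * ρ = V⁻¹ * (V * diagonal (fun i => -(e i)⁻¹)) * ρ := by
          rw [← Matrix.mul_assoc V⁻¹ V, nonsing_inv_mul _ hVd, Matrix.one_mul]
      _ = V⁻¹ * (X⁻¹ * S * (V * ρ)) := by rw [← h]; simp only [Matrix.mul_assoc]
      _ = ρ * T := by rw [← hRS', hRS, hρ, Matrix.mul_assoc]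
  refine ⟨ρ *ᵥ w, by rw [mulVec_mulVec, ← hRS'], fun i hi => ?_⟩
  have hρi : ρ i = 0 := by
    by_contra hne
    have := hT.neg_of_vecMul_eq hne (μ := -(e i)⁻¹) (by
      ext j
      have := congrFun (congrFun hrow i) j
      rw [diagonal_mul] at this
      simpa [vecMul, mul_apply, dotProduct] using this.symm)
    have := inv_lt_zero.mpr hi
    linarith
  simp [mulVec, hρi]

end Diagonalized

/-! ### Characteristic decompositions -/

lemma sum_weighted_sq_pos {κ : Type*} [Fintype κ] {e c : κ → ℝ} (he : ∀ i, c i ≠ 0 → 0 < e i)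
    (hc : c ≠ 0) : 0 < ∑ i, e i * c i ^ 2 := by
  obtain ⟨j, hj⟩ := Function.ne_iff.mp hc
  refine Finset.sum_pos' (fun i _ => ?_) ⟨j, Finset.mem_univ j, ?_⟩
  · rcases eq_or_ne (c i) 0 with h | h
    · simp [h]
    · exact mul_nonneg (he i h).le (sq_nonneg _)
  · exact mul_pos (he j hj) (sq_pos_of_ne_zero hj)

lemma dotProduct_mulVec_eq_sum_of_eigen {ι κ : Type*} [Fintype ι] [Fintype κ] [DecidableEq κ]
    {A : Matrix ι ι ℝ} {B : Matrix ι κ ℝ} {e : κ → ℝ} (hB : Bᵀ * B = 1)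
    (h : A * B = B * diagonal e) (c : κ → ℝ) :
    B *ᵥ c ⬝ᵥ A *ᵥ (B *ᵥ c) = ∑ i, e i * c i ^ 2 :=
  dotProduct_mulVec_eq_sum
    (by rw [Matrix.mul_assoc, h, ← Matrix.mul_assoc, hB, Matrix.one_mul]) c

lemma orthonormal_blocks {ι κ₁ κ₂ : Type*} [Fintype ι] [DecidableEq κ₁] [DecidableEq κ₂]
    {B : Matrix ι κ₁ ℝ} {C : Matrix ι κ₂ ℝ} (h : (fromCols B C)ᵀ * fromCols B C = 1) :
    Bᵀ * B = 1 ∧ Bᵀ * C = 0 ∧ Cᵀ * B = 0 ∧ Cᵀ * C = 1 := by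
  rwa [transpose_fromCols, fromRows_mul_fromCols, ← fromBlocks_one, fromBlocks_inj] at h

lemma mul_mul_diagonal_inv_mul_transpose {ι κ : Type*} [Fintype ι] [Fintype κ] [DecidableEq κ]
    {A₁₁ : Matrix ι ι ℝ} {B : Matrix ι κ ℝ} {e : κ → ℝ}
    (he : ∀ i, e i ≠ 0) (h : A₁₁ * B = B * diagonal e) :
    A₁₁ * (B * diagonal (fun i => (e i)⁻¹) * Bᵀ) = B * Bᵀ := by
  rw [← Matrix.mul_assoc, ← Matrix.mul_assoc, h, Matrix.mul_assoc B, diagonal_mul_diagonal]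
  simp [he]

section Decompositions

variable {ι : Type*} [Fintype ι] [DecidableEq ι]

lemma CharDecomp.form_pos {A : Matrix ι ι ℝ} {np nm : ℕ} (R : CharDecomp A np nm)
    {a : Fin np → ℝ} (ha : a ≠ 0) : 0 < R.Rp *ᵥ a ⬝ᵥ A *ᵥ (R.Rp *ᵥ a) := by
  rw [dotProduct_mulVec_eq_sum_of_eigen (orthonormal_blocks R.orthonormal).1 R.eigen_pos]
  exact sum_weighted_sq_pos (fun i _ => R.pos i) ha

lemma CharDecomp.form_neg {A : Matrix ι ι ℝ} {np nm : ℕ} (R : CharDecomp A np nm)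
    {a : Fin nm → ℝ} (ha : a ≠ 0) : R.Rm *ᵥ a ⬝ᵥ A *ᵥ (R.Rm *ᵥ a) < 0 := by
  rw [dotProduct_mulVec_eq_sum_of_eigen (orthonormal_blocks R.orthonormal).2.2.2 R.eigen_neg,
    ← neg_pos, ← Finset.sum_neg_distrib]
  simp only [← neg_mul]
  exact sum_weighted_sq_pos (fun i _ => neg_pos.mpr (R.neg i)) ha

namespace CharDecompEq

variable {A₁₁ : Matrix ι ι ℝ} {n1p n1m n1o : ℕ} (P : CharDecompEq A₁₁ n1p n1m n1o)

lemma form_pos {b : Fin n1p → ℝ} (hb : b ≠ 0) : 0 < P.Pp *ᵥ b ⬝ᵥ A₁₁ *ᵥ (P.Pp *ᵥ b) := by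
  rw [dotProduct_mulVec_eq_sum_of_eigen (orthonormal_blocks P.orthonormal).1 P.eigen_pos]
  exact sum_weighted_sq_pos (fun i _ => P.pos i) hb

lemma form_neg {b : Fin n1m → ℝ} (hb : b ≠ 0) : P.Pm *ᵥ b ⬝ᵥ A₁₁ *ᵥ (P.Pm *ᵥ b) < 0 := by
  rw [dotProduct_mulVec_eq_sum_of_eigen
    (orthonormal_blocks (orthonormal_blocks P.orthonormal).2.2.2).1 P.eigen_neg,
    ← neg_pos, ← Finset.sum_neg_distrib]
  simp only [← neg_mul]
  exact sum_weighted_sq_pos (fun i _ => neg_pos.mpr (P.neg i)) hb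

lemma P0_orthonormal : P.P0ᵀ * P.P0 = 1 :=
  (orthonormal_blocks (orthonormal_blocks P.orthonormal).2.2.2).2.2.2

lemma card_eq (P : CharDecompEq A₁₁ n1p n1m n1o) (hA : A₁₁.IsSymm) : n1p + n1m + n1o = Fintype.card ι := by
  rw [← numPosEig_add_numNegEig_add_numZeroEig hA, ← P.size_pos, ← P.size_neg, ← P.size_zero]

/-- Completeness: there are as many eigenvectors as the size of `A₁₁`, so that they form an
orthonormal basis. -/
lemma complete (hA : A₁₁.IsSymm) :
    P.Pp * P.Ppᵀ + (P.Pm * P.Pmᵀ + P.P0 * P.P0ᵀ) = 1 := by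
  have h := (mul_eq_one_comm_of_card_eq _ _ _ (by
    rw [← P.card_eq hA]; simp [add_assoc])).mp P.orthonormal
  simpa only [transpose_fromCols, fromCols_mul_fromRows] using h

/-- `P.pinv` inverts `A₁₁` up to the projection onto its kernel. -/
lemma mul_pinv (hA : A₁₁.IsSymm) : A₁₁ * P.pinv = 1 - P.P0 * P.P0ᵀ := by
  rw [pinv, Matrix.mul_add, mul_mul_diagonal_inv_mul_transpose (fun i => (P.pos i).ne') P.eigen_pos,
    mul_mul_diagonal_inv_mul_transpose (fun i => (P.neg i).ne) P.eigen_neg, ← P.complete hA]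
  abel

lemma pinv_isSymm : P.pinv.IsSymm := by
  simp [IsSymm, pinv, transpose_mul, Matrix.mul_assoc]

end CharDecompEq

end Decompositions

/-! ### The boundary layer -/

section Layer

variable {r m n1p n1m n1o q : ℕ} {A Q : Matrix (Fin r ⊕ Fin m) (Fin r ⊕ Fin m) ℝ}
  (P : CharDecompEq A.toBlocks₁₁ n1p n1m n1o) {Kt : Matrix (Fin m) (Fin q) ℝ}

lemma toBlocks₁₁_isSymm (hA : A.IsSymm) : A.toBlocks₁₁.IsSymm := by
  ext i j; exact congrFun (congrFun hA (Sum.inl i)) (Sum.inl j)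

lemma toBlocks₂₂_isSymm (hA : A.IsSymm) : A.toBlocks₂₂.IsSymm := by
  ext i j; exact congrFun (congrFun hA (Sum.inr i)) (Sum.inr j)

lemma mulVec_elim (hA : A.IsSymm) (x : Fin r → ℝ) (y : Fin m → ℝ) :
    A *ᵥ Sum.elim x y = Sum.elim (A.toBlocks₁₁ *ᵥ x + A.toBlocks₁₂ *ᵥ y)
      (A.toBlocks₁₂ᵀ *ᵥ x + A.toBlocks₂₂ *ᵥ y) := by
  have h21 : A.toBlocks₂₁ = A.toBlocks₁₂ᵀ := by
    ext i j; exact congrFun (congrFun hA (Sum.inl j)) (Sum.inr i)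
  conv_lhs => rw [← fromBlocks_toBlocks A, fromBlocks_mulVec, h21]
  simp

lemma eq_zero_of_mulVec_eq_zero_of_orthonormal {ι κ : Type*} [Fintype ι] [Fintype κ]
    [DecidableEq κ] {B : Matrix ι κ ℝ} (hB : Bᵀ * B = 1) {x : κ → ℝ} (h : B *ᵥ x = 0) : x = 0 := by
  simpa [mulVec_mulVec, hB] using congrArg (Bᵀ *ᵥ ·) h

/-- A vector of the kernel of `K` would give the kernel vector `(P₀ z, 0)` of `A`. -/
lemma matK_injective (hA : A.IsSymm) (hdet : A.det ≠ 0) :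
    Function.Injective (matK A P).mulVec := by
  refine (injective_iff_map_eq_zero (matK A P).mulVecLin).mpr fun z hz => ?_
  rw [mulVecLin_apply, matK, ← mulVec_mulVec] at hz
  have h0 : A *ᵥ Sum.elim (P.P0 *ᵥ z) 0 = 0 := by
    rw [mulVec_elim hA, hz, mulVec_mulVec, P.eigen_zero]; simp
  have h1 := eq_zero_of_mulVec_eq_zero hdet h0
  refine eq_zero_of_mulVec_eq_zero_of_orthonormal P.P0_orthonormal ?_
  ext i; exact congrFun h1 (Sum.inl i)

lemma isUnit_transpose_mul_self_of_injective {ι κ : Type*} [Fintype ι] [Fintype κ] [DecidableEq κ]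
    {B : Matrix ι κ ℝ} (hB : Function.Injective B.mulVec) : IsUnit (Bᵀ * B) := by
  have := (PosDef.conjTranspose_mul_self B hB).isUnit
  rwa [conjTranspose_eq_transpose_of_trivial] at this

lemma IsOrthogonalComplement.transpose_mul_eq_zero {K : Matrix (Fin m) (Fin n1o) ℝ}
    (h : IsOrthogonalComplement K Kt) : Kᵀ * Kt = 0 := by
  apply Matrix.mulVec_injective
  ext1 w
  rw [← mulVec_mulVec, (h.2 _).mpr ⟨w, rfl⟩, zero_mulVec]

/-- Rank-nullity for `Kᵀ`. -/
lemma IsOrthogonalComplement.add_eq {K : Matrix (Fin m) (Fin n1o) ℝ}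
    (h : IsOrthogonalComplement K Kt) (hK : Function.Injective K.mulVec) : q + n1o = m := by
  have h1 := LinearMap.finrank_range_add_finrank_ker Kᵀ.mulVecLin
  have hker : LinearMap.ker Kᵀ.mulVecLin = LinearMap.range Kt.mulVecLin := by
    ext v
    simp only [LinearMap.mem_ker, LinearMap.mem_range, mulVecLin_apply, h.2 v, eq_comm]
  have h2 : Module.finrank ℝ (LinearMap.range Kt.mulVecLin) = q := by
    rw [LinearMap.finrank_range_of_inj h.1]; simp
  have h3 : Module.finrank ℝ (LinearMap.range Kᵀ.mulVecLin) = n1o := by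
    change Kᵀ.rank = n1o
    rw [rank_transpose]
    change Module.finrank ℝ (LinearMap.range K.mulVecLin) = n1o
    rw [LinearMap.finrank_range_of_inj hK]; simp
  rw [hker, h2, h3] at h1
  simp at h1
  omega

/-- The range of `K` contains the vectors orthogonal to the columns of `Kt`. -/
lemma IsOrthogonalComplement.exists_eq_mulVec {K : Matrix (Fin m) (Fin n1o) ℝ}
    (h : IsOrthogonalComplement K Kt) (hK : Function.Injective K.mulVec) {v : Fin m → ℝ}
    (hv : Ktᵀ *ᵥ v = 0) : ∃ z, v = K *ᵥ z := by
  have hu := (isUnit_iff_isUnit_det _).mp (isUnit_transpose_mul_self_of_injective hK)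
  -- Subtracting the orthogonal projection onto the range of `K` leaves a vector that is
  -- orthogonal to `K` and `Kt`, hence to itself.
  set z := (Kᵀ * K)⁻¹ *ᵥ (Kᵀ *ᵥ v) with hz
  have h1 : Kᵀ *ᵥ (v - K *ᵥ z) = 0 := by
    rw [mulVec_sub, hz, mulVec_mulVec, mulVec_mulVec, mul_nonsing_inv _ hu, one_mulVec, sub_self]
  obtain ⟨w, hw⟩ := (h.2 _).mp h1
  have h2 : (v - K *ᵥ z) ⬝ᵥ (v - K *ᵥ z) = 0 := by
    nth_rewrite 1 [hw]
    have : Ktᵀ * K = 0 := by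
      rw [← transpose_transpose K, ← transpose_mul, h.transpose_mul_eq_zero, transpose_zero]
    rw [mulVec_dotProduct, mulVec_sub, hv, mulVec_mulVec, this]
    simp
  exact ⟨z, sub_eq_zero.mp (dotProduct_self_eq_zero.mp h2)⟩

lemma matX_isSymm (hA : A.IsSymm) : (matX A P).IsSymm := by
  simp [IsSymm, matX, transpose_mul, P.pinv_isSymm.eq, (toBlocks₂₂_isSymm hA).eq, Matrix.mul_assoc]

lemma transpose_toBlocks₁₂_mul_P0 : P.P0ᵀ * A.toBlocks₁₂ = (matK A P)ᵀ := by
  simp [matK, transpose_mul]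

/-- A kernel vector of `Ktᵀ X Kt` lifts to a kernel vector of `A`. -/
lemma isUnit_transpose_mul_matX_mul (hA : A.IsSymm) (hdet : A.det ≠ 0)
    (hKt : IsOrthogonalComplement (matK A P) Kt) : IsUnit (Ktᵀ * matX A P * Kt) := by
  rw [← mulVec_injective_iff_isUnit]
  refine (injective_iff_map_eq_zero (Ktᵀ * matX A P * Kt).mulVecLin).mpr fun w hw => ?_
  rw [mulVecLin_apply, Matrix.mul_assoc, ← mulVec_mulVec] at hw
  obtain ⟨z, hz⟩ := hKt.exists_eq_mulVec (matK_injective P hA hdet) hw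
  have hA11 := toBlocks₁₁_isSymm hA
  have h0 : A *ᵥ Sum.elim (-((P.pinv * A.toBlocks₁₂ * Kt) *ᵥ w) - P.P0 *ᵥ z) (Kt *ᵥ w) = 0 := by
    rw [mulVec_elim hA]
    have e1 : A.toBlocks₁₁ *ᵥ (-((P.pinv * A.toBlocks₁₂ * Kt) *ᵥ w) - P.P0 *ᵥ z)
        + A.toBlocks₁₂ *ᵥ (Kt *ᵥ w) = 0 := by
      have : A.toBlocks₁₁ * (P.pinv * A.toBlocks₁₂ * Kt) = A.toBlocks₁₂ * Kt := by
        calc A.toBlocks₁₁ * (P.pinv * A.toBlocks₁₂ * Kt)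
            = (A.toBlocks₁₁ * P.pinv) * (A.toBlocks₁₂ * Kt) := by simp only [Matrix.mul_assoc]
          _ = A.toBlocks₁₂ * Kt - P.P0 * ((P.P0ᵀ * A.toBlocks₁₂) * Kt) := by
            rw [P.mul_pinv hA11, Matrix.sub_mul, Matrix.one_mul]; simp only [Matrix.mul_assoc]
          _ = A.toBlocks₁₂ * Kt := by
            rw [transpose_toBlocks₁₂_mul_P0, hKt.transpose_mul_eq_zero]; simp
      rw [mulVec_sub, mulVec_neg, mulVec_mulVec, mulVec_mulVec, this, P.eigen_zero, mulVec_mulVec]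
      simp
    have e2 : A.toBlocks₁₂ᵀ *ᵥ (-((P.pinv * A.toBlocks₁₂ * Kt) *ᵥ w) - P.P0 *ᵥ z)
        + A.toBlocks₂₂ *ᵥ (Kt *ᵥ w) = 0 := by
      rw [matX, matK] at hz
      simp only [← mulVec_mulVec, sub_mulVec] at hz
      simp only [mulVec_sub, mulVec_neg, ← mulVec_mulVec, ← hz]
      abel
    rw [e1, e2]; simp
  have h1 := eq_zero_of_mulVec_eq_zero hdet h0
  have h2 : Kt *ᵥ w = Kt *ᵥ 0 := by
    rw [mulVec_zero]; ext i; exact congrFun h1 (Sum.inr i)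
  exact hKt.1 h2

lemma neg_transpose_mul_mul_posDef {S : Matrix (Fin m) (Fin m) ℝ} (hS : (-S).PosDef)
    (hKt : Function.Injective Kt.mulVec) : (-(Ktᵀ * S * Kt)).PosDef := by
  have := hS.conjTranspose_mul_mul_same hKt
  rw [conjTranspose_eq_transpose_of_trivial] at this
  simpa using this

lemma toBlocks₁₁_mul_matN_add (hA : A.IsSymm) (hKt : IsOrthogonalComplement (matK A P) Kt) :
    A.toBlocks₁₁ * matN A Q P Kt + A.toBlocks₁₂ * Kt = 0 := by
  have hker : (P.P0ᵀ * A.toBlocks₁₂) * Kt = 0 := by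
    rw [transpose_toBlocks₁₂_mul_P0, hKt.transpose_mul_eq_zero]
  rw [matN]
  simp only [Matrix.mul_add, ← Matrix.mul_assoc, P.eigen_zero, Matrix.zero_mul, add_zero,
    Matrix.mul_neg, Matrix.neg_mul, P.mul_pinv (toBlocks₁₁_isSymm hA), Matrix.sub_mul,
    Matrix.one_mul]
  rw [Matrix.mul_assoc P.P0, Matrix.mul_assoc P.P0, hker]
  simp

lemma transpose_mul_matN_add (hKt : IsOrthogonalComplement (matK A P) Kt) :
    Ktᵀ * (A.toBlocks₁₂ᵀ * matN A Q P Kt + A.toBlocks₂₂ * Kt) = Ktᵀ * matX A P * Kt := by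
  have hker : Ktᵀ * (A.toBlocks₁₂ᵀ * P.P0) = 0 := by
    rw [← matK, ← transpose_transpose (matK A P), ← transpose_mul, hKt.transpose_mul_eq_zero,
      transpose_zero]
  rw [← Matrix.mul_assoc] at hker
  rw [matN, matX]
  simp only [Matrix.mul_add, ← Matrix.mul_assoc, hker, Matrix.zero_mul,
    Matrix.mul_neg, Matrix.neg_mul, Matrix.mul_sub, Matrix.sub_mul]
  abel

/-- The energy `Uᵀ A U` of an outer state plus a layer correction splits: the layer correction is
`A`-orthogonal to every `(p, 0)`, and its own energy is that of `Ktᵀ X Kt`. -/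
lemma energy_layer (hA : A.IsSymm) (hKt : IsOrthogonalComplement (matK A P) Kt)
    (p : Fin r → ℝ) (y : Fin q → ℝ) :
    Sum.elim (p + matN A Q P Kt *ᵥ y) (Kt *ᵥ y) ⬝ᵥ
        A *ᵥ Sum.elim (p + matN A Q P Kt *ᵥ y) (Kt *ᵥ y) =
      p ⬝ᵥ A.toBlocks₁₁ *ᵥ p + y ⬝ᵥ (Ktᵀ * matX A P * Kt) *ᵥ y := by
  have htop : A.toBlocks₁₁ *ᵥ (matN A Q P Kt *ᵥ y) + A.toBlocks₁₂ *ᵥ (Kt *ᵥ y) = 0 := by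
    rw [mulVec_mulVec, mulVec_mulVec, ← add_mulVec, toBlocks₁₁_mul_matN_add P hA hKt, zero_mulVec]
  have hbot : Kt *ᵥ y ⬝ᵥ (A.toBlocks₁₂ᵀ *ᵥ (matN A Q P Kt *ᵥ y) + A.toBlocks₂₂ *ᵥ (Kt *ᵥ y))
      = y ⬝ᵥ (Ktᵀ * matX A P * Kt) *ᵥ y := by
    rw [mulVec_mulVec, mulVec_mulVec, ← add_mulVec, mulVec_dotProduct, mulVec_mulVec,
      transpose_mul_matN_add P hKt]
  have hcross : matN A Q P Kt *ᵥ y ⬝ᵥ A.toBlocks₁₁ *ᵥ p + Kt *ᵥ y ⬝ᵥ A.toBlocks₁₂ᵀ *ᵥ p = 0 := by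
    have e1 := mulVec_dotProduct A.toBlocks₁₁ (matN A Q P Kt *ᵥ y) p
    have e2 := mulVec_dotProduct A.toBlocks₁₂ (Kt *ᵥ y) p
    rw [(toBlocks₁₁_isSymm hA).eq] at e1
    rw [← e1, ← e2, ← add_dotProduct, htop, zero_dotProduct]
  rw [mulVec_elim hA, sumElim_dotProduct_sumElim, mulVec_add, mulVec_add, add_assoc, htop, add_zero,
    add_dotProduct, ← hbot, add_assoc, dotProduct_add, dotProduct_add, dotProduct_add]
  linarith

/-- Energy argument: if, up to the common sign `ε`, the form of `A` is negative on the columns of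
`R₁` and the forms of `A₁₁` and `Ktᵀ X Kt` are positive on the columns of `P₁` and `Y`, then the
matrix `(-R₁, (P₁; 0), (P₀; 0), (N Y; Kt Y))` is injective. -/
lemma fromCols_mulVec_injective (hA : A.IsSymm)
    (hKt : IsOrthogonalComplement (matK A P) Kt) (ε : ℝ) {κ₁ κ₂ κ₃ : Type*}
    [Fintype κ₁] [Fintype κ₂] [Fintype κ₃] (R₁ : Matrix (Fin r ⊕ Fin m) κ₁ ℝ)
    (P₁ : Matrix (Fin r) κ₂ ℝ) (Y : Matrix (Fin q) κ₃ ℝ)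
    (hR : ∀ a, a ≠ 0 → ε * (R₁ *ᵥ a ⬝ᵥ A *ᵥ (R₁ *ᵥ a)) < 0)
    (hP : ∀ b, b ≠ 0 → 0 < ε * (P₁ *ᵥ b ⬝ᵥ A.toBlocks₁₁ *ᵥ (P₁ *ᵥ b)))
    (hY : ∀ c, c ≠ 0 → 0 < ε * (Y *ᵥ c ⬝ᵥ (Ktᵀ * matX A P * Kt) *ᵥ (Y *ᵥ c))) :
    Function.Injective (fromCols (-R₁) (fromCols (fromRows P₁ 0) (fromCols (fromRows P.P0 0)
      (fromRows (matN A Q P Kt * Y) (Kt * Y))))).mulVec := by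
  rw [← coe_mulVecLin, injective_iff_map_eq_zero]
  intro x hx
  obtain ⟨a, x, rfl⟩ : ∃ a y, x = Sum.elim a y := ⟨_, _, (Sum.elim_comp_inl_inr x).symm⟩
  obtain ⟨b, x, rfl⟩ : ∃ a y, x = Sum.elim a y := ⟨_, _, (Sum.elim_comp_inl_inr x).symm⟩
  obtain ⟨h, c, rfl⟩ : ∃ a y, x = Sum.elim a y := ⟨_, _, (Sum.elim_comp_inl_inr x).symm⟩
  have hR₁ : R₁ *ᵥ a = Sum.elim (P₁ *ᵥ b + P.P0 *ᵥ h + matN A Q P Kt *ᵥ (Y *ᵥ c))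
      (Kt *ᵥ (Y *ᵥ c)) := by
    rw [mulVecLin_apply] at hx
    simp only [fromCols_mulVec_sumElim, fromRows_mulVec, neg_mulVec, zero_mulVec] at hx
    rw [neg_add_eq_zero.mp hx]
    ext (i | i) <;> simp [mulVec_mulVec, add_assoc]
  have hp : (P₁ *ᵥ b + P.P0 *ᵥ h) ⬝ᵥ A.toBlocks₁₁ *ᵥ (P₁ *ᵥ b + P.P0 *ᵥ h)
      = P₁ *ᵥ b ⬝ᵥ A.toBlocks₁₁ *ᵥ (P₁ *ᵥ b) := by
    have h0 : A.toBlocks₁₁ *ᵥ (P.P0 *ᵥ h) = 0 := by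
      rw [mulVec_mulVec, P.eigen_zero, zero_mulVec]
    have h1 : P.P0 *ᵥ h ⬝ᵥ A.toBlocks₁₁ *ᵥ (P₁ *ᵥ b) = 0 := by
      have := mulVec_dotProduct A.toBlocks₁₁ (P.P0 *ᵥ h) (P₁ *ᵥ b)
      rw [(toBlocks₁₁_isSymm hA).eq] at this
      rw [← this, h0, zero_dotProduct]
    rw [mulVec_add, h0, add_zero, add_dotProduct, h1, add_zero]
  have hen : R₁ *ᵥ a ⬝ᵥ A *ᵥ (R₁ *ᵥ a) = P₁ *ᵥ b ⬝ᵥ A.toBlocks₁₁ *ᵥ (P₁ *ᵥ b)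
      + Y *ᵥ c ⬝ᵥ (Ktᵀ * matX A P * Kt) *ᵥ (Y *ᵥ c) := by
    rw [hR₁, energy_layer P hA hKt, hp]
  have hen' := congrArg (ε * ·) hen
  simp only [mul_add] at hen'
  have hR' : ε * (R₁ *ᵥ a ⬝ᵥ A *ᵥ (R₁ *ᵥ a)) ≤ 0 := by
    rcases eq_or_ne a 0 with rfl | h
    · simp
    · exact (hR a h).le
  have hP' : 0 ≤ ε * (P₁ *ᵥ b ⬝ᵥ A.toBlocks₁₁ *ᵥ (P₁ *ᵥ b)) := by
    rcases eq_or_ne b 0 with rfl | h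
    · simp
    · exact (hP b h).le
  have hY' : 0 ≤ ε * (Y *ᵥ c ⬝ᵥ (Ktᵀ * matX A P * Kt) *ᵥ (Y *ᵥ c)) := by
    rcases eq_or_ne c 0 with rfl | h
    · simp
    · exact (hY c h).le
  obtain rfl : a = 0 := by by_contra h; linarith [hR a h]
  obtain rfl : b = 0 := by by_contra h; linarith [hP b h]
  obtain rfl : c = 0 := by by_contra h; linarith [hY c h]
  obtain rfl : h = 0 := by
    refine eq_zero_of_mulVec_eq_zero_of_orthonormal P.P0_orthonormal ?_
    ext i
    simpa using (congrFun hR₁ (Sum.inl i)).symm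
  simp

end Layer

/-! ### Dimension count and solvability -/

/-- Selecting some of the columns that diagonalize a form. -/
lemma submatrix_diagonalizes {ι κ : Type*} [Fintype ι] [DecidableEq ι] [DecidableEq κ]
    {X V : Matrix ι ι ℝ} {e : ι → ℝ} (h : Vᵀ * X * V = diagonal e) {φ : κ → ι}
    (hφ : Function.Injective φ) :
    (V.submatrix id φ)ᵀ * X * V.submatrix id φ = diagonal (e ∘ φ) := by
  rw [← submatrix_diagonal e φ hφ, ← h]
  rfl

lemma card_le_card_of_mulVec_injective {ι κ : Type*} [Fintype ι] [Fintype κ]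
    {C : Matrix ι κ ℝ} (hC : Function.Injective C.mulVec) : Fintype.card κ ≤ Fintype.card ι := by
  have := LinearMap.finrank_le_finrank_of_injective (f := C.mulVecLin) hC
  simpa using this

lemma mulVec_bijective_of_injective {ι κ : Type*} [Fintype ι] [Fintype κ]
    {C : Matrix ι κ ℝ} (hC : Function.Injective C.mulVec)
    (hcard : Fintype.card κ = Fintype.card ι) : Function.Bijective C.mulVec :=
  ⟨hC, (LinearMap.injective_iff_surjective_of_finrank_eq_finrank (f := C.mulVecLin)
    (by simpa using hcard)).mp hC⟩

lemma exists_inverse_of_mulVec_bijective {ι κ : Type*} [Fintype ι] [Fintype κ] [DecidableEq ι]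
    [DecidableEq κ] {C : Matrix ι κ ℝ} (hC : Function.Bijective C.mulVec) :
    ∃ D : Matrix κ ι ℝ, ∀ x b, C *ᵥ x = b ↔ x = D *ᵥ b := by
  let f := LinearEquiv.ofBijective C.mulVecLin hC
  refine ⟨LinearMap.toMatrix' f.symm.toLinearMap, fun x b => ?_⟩
  rw [LinearMap.toMatrix'_mulVec]
  exact (LinearEquiv.eq_symm_apply f).symm

section

variable {r m n1p n1m n1o q s np nm : ℕ} {A Q : Matrix (Fin r ⊕ Fin m) (Fin r ⊕ Fin m) ℝ}
  {P : CharDecompEq A.toBlocks₁₁ n1p n1m n1o} {Kt : Matrix (Fin m) (Fin q) ℝ}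
  {RS : Matrix (Fin q) (Fin s) ℝ}

/-- `Ktᵀ X Kt` is positive definite on the stable subspace of the layer equation. -/
lemma form_pos_of_stable {V : Matrix (Fin q) (Fin q) ℝ} {e : Fin q → ℝ} {X S : Matrix _ _ ℝ}
    (hXu : IsUnit X) (hV : IsUnit V) (he : ∀ i, e i ≠ 0)
    (hVX : Vᵀ * X * V = diagonal e) (hVS : Vᵀ * S * V = -1)
    (hRS : IsRightStable (X⁻¹ * S) RS) {w : Fin s → ℝ} (hw : w ≠ 0) :
    0 < RS *ᵥ w ⬝ᵥ X *ᵥ (RS *ᵥ w) := by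
  obtain ⟨T, hT, hMT⟩ := hRS.invariant
  obtain ⟨c, hc, hc0⟩ := exists_coordinates_of_stable hXu hV he hVX hVS hT hMT w
  rw [← hc, dotProduct_mulVec_eq_sum hVX]
  refine sum_weighted_sq_pos (fun i hi => ?_) ?_
  · exact lt_of_le_of_ne (not_lt.mp fun h => hi (hc0 i h)) (he i).symm
  · rintro rfl
    refine hw (hRS.fullRank ?_)
    rw [← hc, mulVec_zero, mulVec_zero]

/-- The coupling matrix is injective, and it is square: the energy argument for
`(R₋, P₊, stable directions)` bounds `n⁺` from below, and with the opposite sign, for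
`(R₊, P₋, unstable directions)`, it bounds `n⁺` from above. -/
lemma couplingMatrix_injective_and_size (hstab : StructuralStability A Q) (hdet : A.det ≠ 0)
    (R : CharDecomp A np nm) (hKt : IsOrthogonalComplement (matK A P) Kt)
    (hRS : IsRightStable (layerMatrix A Q P Kt) RS) :
    IsUnit (Ktᵀ * Q.toBlocks₂₂ * Kt) ∧ Function.Injective (couplingMatrix A Q R P Kt RS).mulVec ∧
      s + n1o + n1p = np ∧ nm + n1p + n1o + s = r + m := by
  have hA := hstab.symm_A
  obtain ⟨S, -, hS, hQ⟩ := hstab.block_Q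
  have hQ22 : Q.toBlocks₂₂ = S := by rw [hQ, toBlocks_fromBlocks₂₂]
  have hSt : (-(Ktᵀ * Q.toBlocks₂₂ * Kt)).PosDef := by
    rw [hQ22]; exact neg_transpose_mul_mul_posDef hS hKt.1
  have hXu := isUnit_transpose_mul_matX_mul P hA hdet hKt
  have hXs : (Ktᵀ * matX A P * Kt).IsSymm := by
    simp [IsSymm, transpose_mul, (matX_isSymm P hA).eq, Matrix.mul_assoc]
  obtain ⟨V, e, hV, he, hVX, hVS⟩ := exists_simultaneous_diagonalization hXs hXu hSt
  have hs := hRS.size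
  rw [layerMatrix, numStableEig_inv_mul hXu hV he hVX hVS] at hs
  have hinj : Function.Injective (couplingMatrix A Q R P Kt RS).mulVec :=
    fromCols_mulVec_injective P hA hKt 1 R.Rm P.Pp RS
      (fun a ha => by rw [one_mul]; exact R.form_neg ha)
      (fun b hb => by rw [one_mul]; exact P.form_pos hb)
      (fun c hc => by rw [one_mul]; exact form_pos_of_stable hXu hV he hVX hVS hRS hc)
  have hYX := submatrix_diagonalizes hVX (φ := (Subtype.val : {i // e i < 0} → Fin q))
    Subtype.val_injective
  have hinj' := fromCols_mulVec_injective (Q := Q) P hA hKt (-1) R.Rp P.Pm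
      (V.submatrix id (Subtype.val : {i // e i < 0} → Fin q))
      (fun a ha => by linarith [R.form_pos ha])
      (fun b hb => by linarith [P.form_neg hb])
      (fun c hc => by
        rw [dotProduct_mulVec_eq_sum hYX, Finset.mul_sum]
        simp only [← mul_assoc]
        exact sum_weighted_sq_pos (fun i _ => by
          have := i.2
          simpa using this) hc)
  have hst : Fintype.card {i // 0 < e i} + Fintype.card {i // e i < 0} = q := by
    have : Fintype.card {i // e i < 0} = Fintype.card {i // ¬ 0 < e i} :=
      Fintype.card_congr (Equiv.subtypeEquivRight fun i =>
        ⟨fun h => h.not_gt, fun h => lt_of_le_of_ne (not_lt.mp h) (he i)⟩)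
    rw [this, Fintype.card_subtype_compl]
    have := Fintype.card_subtype_le (fun i => 0 < e i)
    simp only [Fintype.card_fin] at this ⊢
    omega
  have c1 := card_le_card_of_mulVec_injective hinj
  have c2 := card_le_card_of_mulVec_injective hinj'
  have c3 := numPosEig_add_numNegEig_add_numZeroEig hA
  have c4 := P.card_eq (toBlocks₁₁_isSymm hA)
  have c5 := hKt.add_eq (matK_injective P hA hdet)
  rw [numZeroEig_eq_zero hdet, ← R.size_pos, ← R.size_neg] at c3
  simp only [Fintype.card_sum, Fintype.card_fin] at c1 c2 c3 c4
  refine ⟨?_, hinj, by omega, by omega⟩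
  have := hSt.isUnit.neg
  rwa [neg_neg] at this

/-- The matching relation is the coupling system with `ŵ` shifted by `β₀`; this is why `β₀` drops
out of the coupling conditions. -/
lemma matching_iff (R : CharDecomp A np nm) (αp : Fin np → ℝ) (αm : Fin nm → ℝ) (βp : Fin n1p → ℝ)
    (βm : Fin n1m → ℝ) (β0 wHat : Fin n1o → ℝ) (wS : Fin s → ℝ) :
    Matching A Q P Kt RS (R.Rp *ᵥ αp + R.Rm *ᵥ αm)
        (P.Pp *ᵥ βp + P.Pm *ᵥ βm + P.P0 *ᵥ β0) wHat wS ↔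
      couplingMatrix A Q R P Kt RS *ᵥ Sum.elim αm (Sum.elim βp (Sum.elim (wHat + β0) wS)) =
        R.Rp *ᵥ αp - fromRows P.Pm 0 *ᵥ βm := by
  rw [Matching, couplingMatrix]
  simp only [fromCols_mulVec_sumElim, fromRows_mulVec, neg_mulVec, zero_mulVec, mulVec_add,
    ← mulVec_mulVec, funext_iff, Sum.forall, Pi.add_apply, Pi.sub_apply, Pi.neg_apply,
    Sum.elim_inl, Sum.elim_inr, Pi.zero_apply]
  refine and_congr (forall_congr' fun i => ?_) (forall_congr' fun i => ?_) <;>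
    constructor <;> intro h <;> linarith

end

end Relaxation
end

open Relaxation in
theorem theorem2p1 {r m : ℕ}
    (A Q : Matrix (Fin r ⊕ Fin m) (Fin r ⊕ Fin m) ℝ)
    (hstab : StructuralStability A Q) (hA : A.det ≠ 0)
    {np nm : ℕ} (R : CharDecomp A np nm)
    {n1p n1m n1o : ℕ} (P : CharDecompEq A.toBlocks₁₁ n1p n1m n1o)
    {q : ℕ} (Kt : Matrix (Fin m) (Fin q) ℝ) (hKt : IsOrthogonalComplement (matK A P) Kt)
    {s : ℕ} (RS : Matrix (Fin q) (Fin s) ℝ) (hRS : IsRightStable (layerMatrix A Q P Kt) RS) :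
    -- the inverses that enter the coefficient matrix are genuine inverses
    (IsUnit ((matK A P)ᵀ * matK A P) ∧ IsUnit (Ktᵀ * matX A P * Kt) ∧
      IsUnit (Ktᵀ * Q.toBlocks₂₂ * Kt)) ∧
    -- the system has as many unknowns as equations
    (s + n1o + n1p = np ∧ nm + n1p + n1o + s = r + m) ∧
    -- its coefficient matrix is invertible, so that it is uniquely solvable
    Function.Bijective (couplingMatrix A Q R P Kt RS).mulVec ∧
    (∀ (αp : Fin np → ℝ) (βm : Fin n1m → ℝ) (β0 : Fin n1o → ℝ),
      ∃! y : (Fin nm → ℝ) × (Fin n1p → ℝ) × (Fin n1o → ℝ) × (Fin s → ℝ),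
        couplingMatrix A Q R P Kt RS *ᵥ
            Sum.elim y.1 (Sum.elim y.2.1 (Sum.elim y.2.2.1 y.2.2.2)) =
          couplingRhs A R P αp βm β0) ∧
    -- the resulting coupling conditions, with constant matrices and without `β₀`
    ∃ (Bll : Matrix (Fin nm) (Fin np) ℝ) (Blr : Matrix (Fin nm) (Fin n1m) ℝ)
      (Brr : Matrix (Fin n1p) (Fin n1m) ℝ) (Brl : Matrix (Fin n1p) (Fin np) ℝ),
      ∀ (αp : Fin np → ℝ) (αm : Fin nm → ℝ)
        (βp : Fin n1p → ℝ) (βm : Fin n1m → ℝ) (β0 : Fin n1o → ℝ),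
        (∃ (wHat : Fin n1o → ℝ) (wS : Fin s → ℝ),
          Matching A Q P Kt RS (R.Rp *ᵥ αp + R.Rm *ᵥ αm)
            (P.Pp *ᵥ βp + P.Pm *ᵥ βm + P.P0 *ᵥ β0) wHat wS) ↔
        (αm = Bll *ᵥ αp + Blr *ᵥ βm ∧ βp = Brr *ᵥ βm + Brl *ᵥ αp) := by
  obtain ⟨hSu, hinj, hs, hn⟩ := couplingMatrix_injective_and_size hstab hA R hKt hRS
  have hbij : Function.Bijective (couplingMatrix A Q R P Kt RS).mulVec :=
    mulVec_bijective_of_injective hinj (by simp only [Fintype.card_sum, Fintype.card_fin]; omega)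
  refine ⟨⟨isUnit_transpose_mul_self_of_injective (matK_injective P hstab.symm_A hA),
    isUnit_transpose_mul_matX_mul P hstab.symm_A hA hKt, hSu⟩, ⟨hs, hn⟩, hbij, ?_, ?_⟩
  · intro αp βm β0
    obtain ⟨x, hx, hux⟩ := hbij.existsUnique (couplingRhs A R P αp βm β0)
    refine ⟨(x ∘ Sum.inl, x ∘ Sum.inr ∘ Sum.inl, x ∘ Sum.inr ∘ Sum.inr ∘ Sum.inl,
      x ∘ Sum.inr ∘ Sum.inr ∘ Sum.inr), ?_, ?_⟩
    · rw [← hx]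
      congr 1
      ext (i | i | i | i) <;> rfl
    · rintro ⟨a, b, c, d⟩ hy
      rw [← hux _ hy]
      rfl
  · obtain ⟨D, hD⟩ := exists_inverse_of_mulVec_bijective hbij
    -- `D` inverts the coupling matrix; its row blocks `D₁` and `D₂` give `α₋` and `β₊`.
    let D₁ : Matrix (Fin nm) (Fin r ⊕ Fin m) ℝ := D.toRows₁
    let D₂ : Matrix (Fin n1p) (Fin r ⊕ Fin m) ℝ := D.toRows₂.toRows₁
    let C : Matrix (Fin r ⊕ Fin m) (Fin n1m) ℝ := fromRows P.Pm 0
    refine ⟨D₁ * R.Rp, -(D₁ * C), -(D₂ * C),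
      D₂ * R.Rp, fun αp αm βp βm β0 => ?_⟩
    let b := R.Rp *ᵥ αp - C *ᵥ βm
    have h1 : (D₁ * R.Rp) *ᵥ αp + (-(D₁ * C)) *ᵥ βm
        = (D *ᵥ b) ∘ Sum.inl := by
      rw [neg_mulVec, ← mulVec_mulVec, ← mulVec_mulVec, ← sub_eq_add_neg, ← mulVec_sub]; rfl
    have h2 : (-(D₂ * C)) *ᵥ βm + (D₂ * R.Rp) *ᵥ αp
        = (D *ᵥ b) ∘ Sum.inr ∘ Sum.inl := by
      rw [neg_mulVec, ← mulVec_mulVec, ← mulVec_mulVec, neg_add_eq_sub, ← mulVec_sub]; rfl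
    rw [h1, h2]
    simp only [matching_iff, hD]
    change (∃ wHat wS, Sum.elim αm (Sum.elim βp (Sum.elim (wHat + β0) wS)) = D *ᵥ b) ↔ _
    constructor
    · rintro ⟨wHat, wS, h⟩
      rw [← h]
      exact ⟨rfl, rfl⟩
    · rintro ⟨rfl, rfl⟩
      refine ⟨(D *ᵥ b) ∘ Sum.inr ∘ Sum.inr ∘ Sum.inl - β0, (D *ᵥ b) ∘ Sum.inr ∘ Sum.inr ∘ Sum.inr,
        ?_⟩
      rw [sub_add_cancel]
      ext (i | i | i | i) <;> rfl
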